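/- Let $N\ge 0$ and $1\le r\le C$ be integers. In the combinatorial multi-access network a server holds $N$ files $W_1,\dots,W_N\in\mathbb F_2^F$; there are $C$ caches and $K=\binom{C}{r}$ users $U_g$, one for each $r$-subset $g$ of $[C]$, and $U_g$ reads the caches in $g$ and wants the linear combination $B_g=\sum_n d_{g,n}W_n$, with $d_g\in\mathbb F_2^N$. A scheme with caches of $m$ bits and a message of $n$ bits consists of a finite set $\mathcal P$, cache functions that determine the content $Z_c\in\mathbb F_2^m$ of each cache $c$ from $(P,W_{[N]})$, where $P$ is uniform on $\mathcal P$, and a function that determines the broadcast message $X\in\mathbb F_2^n$ from $(P,(d_g)_g,W_{[N]})$. With $Z_g=(Z_c)_{c\in g}$, it is an *SP-LFR scheme* (secure, private linear function retrieval) if, whatever the laws of the library $W_{[N]}$ and of the demand vectors $d_g$ are, with $P$, $W_{[N]}$ and all the $d_g$ independent, for every $g$ $$H(B_g\mid X,d_g,Z_g)=0,\qquad I(W_{[N]};X)=0,\qquad I\big((d_h)_{h\ne g};X,d_g,Z_g\big)=0 .$$ It has *subpacketization* $L$ if every file is split into $L$ subfiles of equal size and the cache contents and the message are concatenations of blocks,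 each of which is a key plus an $\mathbb F_2$-linear combination of zero-padded (or truncated) subfiles; in the caches, the keys and the coefficients of these combinations are functions of $P$ only, and in the message they are functions of $P$ and the demands only. Let $l$ be the smallest positive integer with $r<2^l$, and for $t\in\{0,\dots,C-r\}$ and $F\ge 1$ let $$M_t(F)=\frac{Nt}{C}+\binom{C-r}{t}\binom{C-1}{r-1}\left\lceil\frac{F}{l\binom{C}{t}}\right\rceil\frac{l}{F},\qquad R_t=\frac{\binom{C}{t+r}}{\binom{C}{t}} .$$ 1. For every $t\in\{0,\dots,C-r\}$ and every $F\ge1$ divisible by $\binom{C}{t}$ there is an SP-LFR scheme with subpacketization $\binom{C}{t}$, caches of exactly $M_t(F)F$ bits and a message of exactly $R_tF+KN$ bits (so that its rate is $R_t$ up to $KN$ bits, a number that does not depend on $F$). 2. For every $F\ge 1$ there is an SP-LFR scheme with caches of $NF$ bits and an empty message; that is, $(N,0)$ is achieved. 3. The lower convex envelope is achieved: there is a constant $\kappa$, depending only on $N,C,r$, such that for every $F\ge1$ that is divisible by $\binom{C}{t}$ for all $t\in\{0,\dots,C-r\}$, and every point $(M,R)$ of the lower boundary of the convex hull of $\{(M_t(F),R_t):0\le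 t\le C-r\}\cup\{(N,0)\}$, there is an SP-LFR scheme with caches of at most $MF$ bits and a message of at most $RF+\kappa$ bits. -/

import Mathlib

open scoped Classical in
/-- The probability that the random variable `X` takes the value `a`, when the outcome `ω` of the
finite sample space has probability `q ω`. -/
noncomputable def probEq {Ω α : Type} [Fintype Ω] (q : Ω → ℝ) (X : Ω → α) (a : α) : ℝ :=
  ∑ ω with X ω = a, q ω

/-- Shannon entropy `H(X)` in bits. -/
noncomputable def entropy {Ω α : Type} [Fintype Ω] [Fintype α] (q : Ω → ℝ) (X : Ω → α) : ℝ :=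
  ∑ a, Real.negMulLog (probEq q X a) / Real.log 2

/-- Conditional entropy `H(X | Y) = H(X, Y) - H(Y)`. -/
noncomputable def condEntropy {Ω α β : Type} [Fintype Ω] [Fintype α] [Fintype β]
    (q : Ω → ℝ) (X : Ω → α) (Y : Ω → β) : ℝ :=
  entropy q (fun ω => (X ω, Y ω)) - entropy q Y

/-- Mutual information `I(X ; Y) = H(X) + H(Y) - H(X, Y)`. -/
noncomputable def mutualInfo {Ω α β : Type} [Fintype Ω] [Fintype α] [Fintype β]
    (q : Ω → ℝ) (X : Ω → α) (Y : Ω → β) : ℝ :=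
  entropy q X + entropy q Y - entropy q (fun ω => (X ω, Y ω))

/-- A user of the combinatorial multi-access network with `C` caches and access degree `r`: there is
exactly one user for each set of `r` caches, and it reads the caches in that set. -/
abbrev User (C r : ℕ) : Type := {g : Finset (Fin C) // g.card = r}

/-- The server's library: `N` files of `F` bits. -/
abbrev Library (N F : ℕ) : Type := Fin N → Fin F → ZMod 2

/-- A demand vector: the coefficients of a linear combination of the `N` files. -/
abbrev Demand (N : ℕ) : Type := Fin N → ZMod 2

/-- The linear combination `d₁ W₁ + ⋯ + d_N W_N` of the files. -/
def linComb {N F : ℕ} (d : Demand N) (W : Library N F) : Fin F → ZMod 2 :=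
  ∑ i, d i • W i

/-- A coded caching scheme for `N` files of `F` bits, with caches of `m` bits and a broadcast
message of `n` bits: the server draws an element of the finite set `Rand` uniformly at random, fills
the caches with `place` before the demands are known, and answers the demands with `send`. -/
structure CachingScheme (N C r F m n : ℕ) where
  Rand : Type
  [fintypeRand : Fintype Rand]
  [nonemptyRand : Nonempty Rand]
  place : Fin C → Rand → Library N F → (Fin m → ZMod 2)
  send : Rand → (User C r → Demand N) → Library N F → (Fin n → ZMod 2)

attribute [instance] CachingScheme.fintypeRand CachingScheme.nonemptyRand

namespace CachingScheme

variable {N C r F m n : ℕ}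

/-- The sample space: server randomness, demands of all users, library. -/
abbrev Outcome (S : CachingScheme N C r F m n) : Type :=
  S.Rand × (User C r → Demand N) × Library N F

/-- The joint distribution: the server's randomness is uniform, the library has law `pW`, the demand
of the user `g` has law `pd g`, and all of them are independent. -/
noncomputable def jointProb (S : CachingScheme N C r F m n) (pW : PMF (Library N F))
    (pd : User C r → PMF (Demand N)) (ω : S.Outcome) : ℝ :=
  (Fintype.card S.Rand : ℝ)⁻¹ * (∏ g, (pd g (ω.2.1 g)).toReal) * (pW ω.2.2).toReal

/-- The library `W_{[N]}`. -/
def files (S : CachingScheme N C r F m n) (ω : S.Outcome) : Library N F := ω.2.2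

/-- The demand vector `d_g` of the user `g`. -/
def demand (S : CachingScheme N C r F m n) (g : User C r) (ω : S.Outcome) : Demand N := ω.2.1 g

/-- The demand vectors of all users other than `g`. -/
def otherDemands (S : CachingScheme N C r F m n) (g : User C r) (ω : S.Outcome) :
    {h : User C r // h ≠ g} → Demand N :=
  fun h => ω.2.1 h.1

/-- The linear combination `B_g` that the user `g` wants. -/
def wanted (S : CachingScheme N C r F m n) (g : User C r) (ω : S.Outcome) : Fin F → ZMod 2 :=
  linComb (ω.2.1 g) ω.2.2

/-- The contents `Z_g` of the caches that the user `g` reads. -/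
def cached (S : CachingScheme N C r F m n) (g : User C r) (ω : S.Outcome) :
    {c : Fin C // c ∈ g.1} → Fin m → ZMod 2 :=
  fun c => S.place c.1 ω.1 ω.2.2

/-- The broadcast message `X`. -/
def message (S : CachingScheme N C r F m n) (ω : S.Outcome) : Fin n → ZMod 2 :=
  S.send ω.1 ω.2.1 ω.2.2

/-- Secure and private linear function retrieval: whatever the laws of the library and of the
demands are, every user decodes the linear combination it wants (correctness), the message reveals
nothing about the library (security), and no user learns anything about the demands of the other
users (privacy). -/
def IsSPLFR (S : CachingScheme N C r F m n) : Prop :=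
  ∀ (pW : PMF (Library N F)) (pd : User C r → PMF (Demand N)),
    (∀ g : User C r, condEntropy (S.jointProb pW pd) (S.wanted g)
      (fun ω => (S.message ω, S.demand g ω, S.cached g ω)) = 0) ∧
    mutualInfo (S.jointProb pW pd) S.files S.message = 0 ∧
    (∀ g : User C r, mutualInfo (S.jointProb pW pd) (S.otherDemands g)
      (fun ω => (S.message ω, S.demand g ω, S.cached g ω)) = 0)

end CachingScheme

/-- Let `e` split every file into `L` subfiles of `s` bits. The word `f`, a function of some data `σ`
and of the library, *operates on subfiles* if it is a concatenation of blocks, each of which is the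
sum of a key that depends on `σ` only and of an `𝔽₂`-linear combination of whole subfiles (padded by
zeros, or cut off, to the length of the block) whose coefficients depend on `σ` only. A block may in
particular be a plain subfile, or a word that does not involve the library. -/
def OperatesOnSubfiles {N F L s k : ℕ} {σ : Type} (e : Fin L × Fin s ≃ Fin F)
    (f : σ → Library N F → Fin k → ZMod 2) : Prop :=
  ∃ (J : ℕ) (len : Fin J → ℕ) (pos : (Σ j : Fin J, Fin (len j)) ≃ Fin k)
    (key : σ → (j : Fin J) → Fin (len j) → ZMod 2)
    (coef : σ → Fin J → Fin N → Fin L → ZMod 2),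
    ∀ (x : σ) (W : Library N F) (j : Fin J) (b : Fin (len j)),
      f x W (pos ⟨j, b⟩) = key x j b +
        ∑ i, ∑ u, coef x j i u * (if h : b.1 < s then W i (e (u, ⟨b.1, h⟩)) else 0)

/-- The scheme has subpacketization `L`: every file is split into `L` subfiles of the same size, and
the cache contents and the message are formed from whole subfiles. -/
def CachingScheme.HasSubpacketization {N C r F m n : ℕ} (S : CachingScheme N C r F m n) (L : ℕ) :
    Prop :=
  ∃ (s : ℕ) (e : Fin L × Fin s ≃ Fin F),
    (∀ c, OperatesOnSubfiles e (S.place c)) ∧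
    OperatesOnSubfiles e
      (fun (x : S.Rand × (User C r → Demand N)) (W : Library N F) => S.send x.1 x.2 W)

/-- The smallest positive integer `l` with `r < 2 ^ l`. -/
noncomputable def fieldDegree (r : ℕ) : ℕ := sInf {l : ℕ | 0 < l ∧ r < 2 ^ l}

/-- The cache size `M` (in files) of the point with parameter `t`, for files of `F` bits. -/
noncomputable def memorySP (N C r F t : ℕ) : ℝ :=
  (N : ℝ) * t / C + ((C - r).choose t : ℝ) * ((C - 1).choose (r - 1) : ℝ) *
    (⌈(F : ℝ) / ((fieldDegree r : ℝ) * (C.choose t : ℝ))⌉₊ : ℝ) * ((fieldDegree r : ℝ) / F)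

/-- The rate `R` (in files) of the point with parameter `t`. -/
noncomputable def rateSP (C r t : ℕ) : ℝ := (C.choose (t + r) : ℝ) / (C.choose t : ℝ)

/-- The memory-rate pairs: one for each `t ∈ {0, …, C - r}`, and `(N, 0)`. -/
def pointsSP (N C r F : ℕ) : Set (ℝ × ℝ) :=
  {p | ∃ t : ℕ, t ≤ C - r ∧ p = (memorySP N C r F t, rateSP C r t)} ∪ {((N : ℝ), 0)}

/-- The lower convex envelope of a set of points of the plane: the lower boundary of its convex
hull. -/
def lowerConvexEnvelope (A : Set (ℝ × ℝ)) : Set (ℝ × ℝ) :=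
  {p | p ∈ convexHull ℝ A ∧ ∀ q ∈ convexHull ℝ A, q.1 = p.1 → p.2 ≤ q.2}

/-! Writing `T ⊆ [C]` for the `t`-subset that indexes a subfile, the transmission for a
`(t + r)`-subset `S` is the sum, over all users `g ⊆ S`, of the linear combination of the subfile
`S \ g` that `g` wants, plus a mask. Its coefficients are the demands plus random masks, sent along,
so that the message reveals neither the library nor the demands. A user `g` can read every other
subfile of the sum, and the transmission mask together with the effect of its own demand mask is
its key for `S \ g`, which is shared additively over `𝔽₂` among the caches of `g`. Any other user
reads a cache that `g` does not, so `g` always misses a share of each foreign key. (The shares could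
be as short as the subfiles; they are padded only to reach the memory of Shamir shares over
`𝔽_{2^l}`.)

Instead of entropies one can then argue with permutations: decoding is a deterministic function of
what a user observes, and a change of the library or of the other demands is undone, as far as can
be observed, by a permutation of the server's randomness. Both properties survive running schemes in
parallel on parts of the files, so rounding the weights of a convex combination to multiples of a
fixed part size yields the convex hull, at the cost of a bounded number of extra bits. -/

section Information

variable {Ω α β : Type} [Fintype Ω]

open scoped Classical in
lemma probEq_eq_sum_ite (q : Ω → ℝ) (X : Ω → α) (a : α) :
    probEq q X a = ∑ ω, if X ω = a then q ω else 0 := by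
  rw [probEq, Finset.sum_filter]

lemma sum_probEq [Fintype α] (q : Ω → ℝ) (X : Ω → α) : ∑ a, probEq q X a = ∑ ω, q ω := by
  classical
  exact Finset.sum_fiberwise _ _ _

lemma sum_probEq_prodMk_right [Fintype β] (q : Ω → ℝ) (X : Ω → α) (Y : Ω → β) (a : α) :
    ∑ b, probEq q (fun ω => (X ω, Y ω)) (a, b) = probEq q X a := by
  classical
  simp only [probEq_eq_sum_ite, Prod.mk.injEq, ite_and]
  rw [Finset.sum_comm]
  refine Finset.sum_congr rfl fun ω _ => ?_
  split_ifs <;> simp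

lemma sum_probEq_prodMk_left [Fintype α] (q : Ω → ℝ) (X : Ω → α) (Y : Ω → β) (b : β) :
    ∑ a, probEq q (fun ω => (X ω, Y ω)) (a, b) = probEq q Y b := by
  classical
  simp only [probEq_eq_sum_ite, Prod.mk.injEq, ite_and]
  rw [Finset.sum_comm]
  exact Finset.sum_congr rfl fun ω _ => by simp

open scoped Classical in
lemma probEq_comp_prodMk (q : Ω → ℝ) (φ : β → α) (Y : Ω → β) (a : α) (b : β) :
    probEq q (fun ω => (φ (Y ω), Y ω)) (a, b) = if a = φ b then probEq q Y b else 0 := by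
  simp only [probEq_eq_sum_ite, Prod.mk.injEq]
  split_ifs with h
  · exact Finset.sum_congr rfl fun ω _ => by grind
  · exact Finset.sum_eq_zero fun ω _ => by grind

lemma probEq_comp_equiv {Ω' : Type} [Fintype Ω'] (e : Ω' ≃ Ω) (q : Ω → ℝ) (X : Ω → α) (a : α) :
    probEq (q ∘ e) (X ∘ e) a = probEq q X a := by
  classical
  simp only [probEq_eq_sum_ite, Function.comp_apply]
  exact Equiv.sum_comp e fun ω => if X ω = a then q ω else 0

lemma probEq_eq_of_perm {q : Ω → ℝ} (e : Equiv.Perm Ω) (hq : ∀ ω, q (e ω) = q ω) {X X' : Ω → α}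
    (h : ∀ ω, X' (e ω) = X ω) (a : α) : probEq q X a = probEq q X' a := by
  rw [← probEq_comp_equiv e q X']
  exact congrArg₂ (probEq · · a) (funext fun ω => (hq ω).symm) (funext fun ω => (h ω).symm)

variable [Fintype α] [Fintype β]

lemma condEntropy_eq_zero_of_factorsThrough (q : Ω → ℝ) {X : Ω → α} {Y : Ω → β}
    (h : X.FactorsThrough Y) : condEntropy q X Y = 0 := by
  classical
  rcases isEmpty_or_nonempty α with hα | hα
  · have : IsEmpty Ω := X.isEmpty
    simp [condEntropy, entropy, probEq]
  · obtain ⟨φ, rfl⟩ := (Function.factorsThrough_iff X).1 h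
    simp only [condEntropy, entropy, Function.comp_apply, Fintype.sum_prod_type_right,
      probEq_comp_prodMk, sub_eq_zero]
    refine Finset.sum_congr rfl fun b _ => ?_
    rw [Finset.sum_eq_single (φ b) (by simp +contextual) (by simp), if_pos rfl]

lemma mutualInfo_eq_zero_of_probEq_prodMk_eq_mul {q : Ω → ℝ} (hq : ∑ ω, q ω = 1) {X : Ω → α}
    {Y : Ω → β} {μ : α → ℝ} {ν : β → ℝ}
    (h : ∀ a b, probEq q (fun ω => (X ω, Y ω)) (a, b) = μ a * ν b) : mutualInfo q X Y = 0 := by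
  have hX : ∀ a, probEq q X a = μ a * ∑ b, ν b := fun a => by
    rw [← sum_probEq_prodMk_right q X Y, Finset.mul_sum]
    exact Finset.sum_congr rfl fun b _ => h a b
  have hY : ∀ b, probEq q Y b = (∑ a, μ a) * ν b := fun b => by
    rw [← sum_probEq_prodMk_left q X Y, Finset.sum_mul]
    exact Finset.sum_congr rfl fun a _ => h a b
  have hX1 : ∑ a, probEq q X a = 1 := (sum_probEq q X).trans hq
  have hY1 : ∑ b, probEq q Y b = 1 := (sum_probEq q Y).trans hq
  have total : (∑ a, μ a) * ∑ b, ν b = 1 := by simpa only [hX, ← Finset.sum_mul] using hX1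
  have hXY : ∀ a b, probEq q (fun ω => (X ω, Y ω)) (a, b) = probEq q X a * probEq q Y b := by
    intro a b
    rw [h, hX, hY]
    linear_combination -(μ a * ν b) * total
  simp only [mutualInfo, entropy, ← Finset.sum_div, ← add_div, Fintype.sum_prod_type, hXY,
    Real.negMulLog_mul, Finset.sum_add_distrib, ← Finset.sum_mul, ← Finset.mul_sum, hX1, hY1,
    one_mul, sub_self]

/-- Here `φ` splits the sample space into two independent parts. -/
lemma mutualInfo_fst_eq_zero {A B : Type} [Fintype A] [Fintype B] (φ : Ω ≃ A × B) {q : Ω → ℝ}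
    (hq : ∑ ω, q ω = 1) {μ : A → ℝ} {ν : B → ℝ} (hμν : ∀ a b, q (φ.symm (a, b)) = μ a * ν b)
    {Y : Ω → β} (hY : ∀ a a' y, probEq ν (fun b => Y (φ.symm (a, b))) y =
      probEq ν (fun b => Y (φ.symm (a', b))) y) :
    mutualInfo q (fun ω => (φ ω).1) Y = 0 := by
  classical
  rcases isEmpty_or_nonempty A with hA | ⟨⟨a₀⟩⟩
  · have : IsEmpty Ω := φ.isEmpty
    simp at hq
  refine mutualInfo_eq_zero_of_probEq_prodMk_eq_mul hq (μ := μ)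
    (ν := probEq ν fun b => Y (φ.symm (a₀, b))) fun a y => ?_
  rw [hY a₀ a, ← probEq_comp_equiv φ.symm]
  simp only [probEq_eq_sum_ite, Fintype.sum_prod_type, Function.comp_apply, hμν, Prod.mk.injEq,
    Equiv.apply_symm_apply, ite_and, Finset.mul_sum, mul_ite, mul_zero]
  rw [Finset.sum_eq_single a (by simp +contextual) (by simp)]
  simp

end Information

lemma sum_toReal_pmf {α : Type} [Fintype α] (p : PMF α) : ∑ a, (p a).toReal = 1 := by
  rw [← ENNReal.toReal_sum fun a _ => p.apply_ne_top a, ← tsum_fintype (L := .unconditional _),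
    p.tsum_coe, ENNReal.toReal_one]

namespace CachingScheme

variable {N C r F m n : ℕ} {S : CachingScheme N C r F m n}

lemma sum_jointProb (pW : PMF (Library N F)) (pd : User C r → PMF (Demand N)) :
    ∑ ω, S.jointProb pW pd ω = 1 := by
  have demands : ∑ d : User C r → Demand N, ∏ g, (pd g (d g)).toReal = 1 := by
    rw [← Fintype.prod_sum fun g δ => (pd g δ).toReal]
    exact Finset.prod_eq_one fun g _ => sum_toReal_pmf (pd g)
  simp only [jointProb, Fintype.sum_prod_type, ← Finset.mul_sum, sum_toReal_pmf, mul_one, demands]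
  simp

/-- The combinatorial form of correctness, security and privacy: users decode with certainty, and
the effect on what can be observed of changing the library, or the demands of the other users, is
undone by a permutation of the server's randomness. -/
structure IsPerfect (S : CachingScheme N C r F m n) : Prop where
  decodes : ∀ (g : User C r) (P P' : S.Rand) (d d' : User C r → Demand N) (W W' : Library N F),
    S.send P d W = S.send P' d' W' → d g = d' g →
    (∀ c ∈ g.1, S.place c P W = S.place c P' W') → linComb (d g) W = linComb (d' g) W'
  hidesLibrary : ∀ (d : User C r → Demand N) (W W' : Library N F),
    ∃ e : Equiv.Perm S.Rand, ∀ P, S.send (e P) d W' = S.send P d W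
  hidesDemands : ∀ (g : User C r) (W : Library N F) (d d' : User C r → Demand N), d g = d' g →
    ∃ e : Equiv.Perm S.Rand, ∀ P, S.send (e P) d' W = S.send P d W ∧
      ∀ c ∈ g.1, S.place c (e P) W = S.place c P W

/-- Separates the demands of the users other than `g` from the rest of the sample space. -/
def splitDemands (S : CachingScheme N C r F m n) (g : User C r) :
    S.Outcome ≃ ({h : User C r // h ≠ g} → Demand N) × (S.Rand × Demand N × Library N F) where
  toFun ω := (S.otherDemands g ω, ω.1, S.demand g ω, ω.2.2)
  invFun x := (x.2.1, (Equiv.funSplitAt g (Demand N)).symm (x.2.2.1, x.1), x.2.2.2)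
  left_inv ω := congrArg (fun d => (ω.1, d, ω.2.2)) ((Equiv.funSplitAt g _).symm_apply_apply ω.2.1)
  right_inv x := by
    have h := (Equiv.funSplitAt g (Demand N)).apply_symm_apply (x.2.2.1, x.1)
    exact congrArg (fun y => (y.2, x.2.1, y.1, x.2.2.2)) h

namespace IsPerfect

lemma condEntropy_wanted (hS : S.IsPerfect) (pW : PMF (Library N F))
    (pd : User C r → PMF (Demand N)) (g : User C r) :
    condEntropy (S.jointProb pW pd) (S.wanted g)
      (fun ω => (S.message ω, S.demand g ω, S.cached g ω)) = 0 := by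
  refine condEntropy_eq_zero_of_factorsThrough _ fun ω ω' h => ?_
  obtain ⟨hX, hd, hZ⟩ : S.message ω = S.message ω' ∧ S.demand g ω = S.demand g ω' ∧
      S.cached g ω = S.cached g ω' := by simpa only [Prod.mk.injEq] using h
  exact hS.decodes g _ _ _ _ _ _ hX hd fun c hc => congrFun hZ ⟨c, hc⟩

lemma mutualInfo_files_message (hS : S.IsPerfect) (pW : PMF (Library N F))
    (pd : User C r → PMF (Demand N)) :
    mutualInfo (S.jointProb pW pd) S.files S.message = 0 := by
  let φ : S.Outcome ≃ Library N F × (S.Rand × (User C r → Demand N)) :=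
    (Equiv.prodAssoc _ _ _).symm.trans (Equiv.prodComm _ _)
  refine mutualInfo_fst_eq_zero φ (sum_jointProb pW pd) (μ := fun W => (pW W).toReal)
    (ν := fun x => (Fintype.card S.Rand : ℝ)⁻¹ * ∏ g, (pd g (x.2 g)).toReal)
    (fun W x => mul_comm _ _) fun W W' x => ?_
  choose e he using fun d => hS.hidesLibrary d W W'
  exact probEq_eq_of_perm (Equiv.prodCongrLeft e) (fun _ => rfl) (fun y => he y.2 y.1) x

lemma mutualInfo_otherDemands (hS : S.IsPerfect) (pW : PMF (Library N F))
    (pd : User C r → PMF (Demand N)) (g : User C r) :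
    mutualInfo (S.jointProb pW pd) (S.otherDemands g)
      (fun ω => (S.message ω, S.demand g ω, S.cached g ω)) = 0 := by
  let glue (a : {h : User C r // h ≠ g} → Demand N) (δ : Demand N) : User C r → Demand N :=
    (Equiv.funSplitAt g (Demand N)).symm (δ, a)
  have glue_self : ∀ a δ, glue a δ g = δ := by simp [glue]
  have glue_other : ∀ a δ (h : {h : User C r // h ≠ g}), glue a δ h = a h := fun a δ h => by
    simp [glue, h.2]
  refine mutualInfo_fst_eq_zero (S.splitDemands g) (sum_jointProb pW pd)
    (μ := fun a => ∏ h, (pd h.1 (a h)).toReal)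
    (ν := fun x => (Fintype.card S.Rand : ℝ)⁻¹ * (pd g x.2.1).toReal * (pW x.2.2).toReal)
    (fun a x => ?_) fun a a' y => ?_
  · change _ * (∏ h, (pd h (glue a x.2.1 h)).toReal) * (pW x.2.2).toReal = _
    rw [Fintype.prod_eq_mul_prod_subtype_ne _ g]
    simp only [glue_self, glue_other]
    ring
  · choose e he using fun x : Demand N × Library N F =>
      hS.hidesDemands g x.2 (glue a x.1) (glue a' x.1) (by rw [glue_self, glue_self])
    refine probEq_eq_of_perm (Equiv.prodCongrLeft e) (fun _ => rfl) (fun x => ?_) y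
    obtain ⟨hX, hZ⟩ := he x.2 x.1
    refine Prod.ext hX (Prod.ext ?_ (funext fun c => hZ c.1 c.2))
    exact (glue_self _ _).trans (glue_self _ _).symm

theorem isSPLFR (hS : S.IsPerfect) : S.IsSPLFR := fun pW pd =>
  ⟨hS.condEntropy_wanted pW pd, hS.mutualInfo_files_message pW pd,
    hS.mutualInfo_otherDemands pW pd⟩

end IsPerfect

end CachingScheme

section Words

/-- The word of length `k` that is the concatenation of the blocks `f j`, where `pos` says which
position of the word each bit of a block occupies. -/
def assemble {ι : Type} {len : ι → ℕ} {k : ℕ} (pos : (Σ j, Fin (len j)) ≃ Fin k) :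
    (∀ j, Fin (len j) → ZMod 2) ≃ (Fin k → ZMod 2) :=
  (Equiv.piCurry fun _ _ => ZMod 2).symm.trans (pos.arrowCongr (Equiv.refl _))

lemma assemble_apply {ι : Type} {len : ι → ℕ} {k : ℕ} (pos : (Σ j, Fin (len j)) ≃ Fin k)
    (f : ∀ j, Fin (len j) → ZMod 2) (j : ι) (b : Fin (len j)) :
    assemble pos f (pos ⟨j, b⟩) = f j b :=
  congrFun (congrFun ((assemble pos).symm_apply_apply f) j) b

/-- The part of the library that consists of the bits at the positions `p b` of each file. -/
def restrict {N F F' : ℕ} (p : Fin F' → Fin F) (W : Library N F) : Library N F' :=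
  fun i => W i ∘ p

lemma linComb_apply {N F : ℕ} (d : Demand N) (W : Library N F) (b : Fin F) :
    linComb d W b = ∑ i, d i * W i b := by
  simp [linComb]

lemma linComb_restrict {N F F' : ℕ} (d : Demand N) (p : Fin F' → Fin F) (W : Library N F) :
    linComb d (restrict p W) = linComb d W ∘ p := by
  ext b
  simp [linComb_apply, restrict]

lemma linComb_zero {N F : ℕ} (W : Library N F) : linComb 0 W = 0 := by
  simp [linComb]

lemma linComb_add {N F : ℕ} (d d' : Demand N) (W : Library N F) :
    linComb (d + d') W = linComb d W + linComb d' W := by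
  simp [linComb, add_smul, Finset.sum_add_distrib]

lemma linComb_single {N F : ℕ} (i : Fin N) (W : Library N F) :
    linComb (Pi.single i 1) W = W i := by
  classical
  simp [linComb, Pi.single_apply, ite_smul]

end Words

namespace CachingScheme

variable {N C r F : ℕ}

/-- Every cache stores the whole library, and nothing is sent. -/
def uncoded (N C r F : ℕ) : CachingScheme N C r F (N * F) 0 where
  Rand := Unit
  place _ _ W := Function.uncurry W ∘ finProdFinEquiv.symm
  send _ _ _ := Fin.elim0

lemma isPerfect_uncoded (hr : 1 ≤ r) : (uncoded N C r F).IsPerfect where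
  decodes g P P' d d' W W' _ hd hZ := by
    obtain ⟨c, hc⟩ : g.1.Nonempty := Finset.card_pos.1 (by rw [g.2]; exact hr)
    have library : Function.uncurry W = Function.uncurry W' :=
      finProdFinEquiv.symm.surjective.injective_comp_right (hZ c hc)
    rw [hd, Function.uncurry_injective library]
  hidesLibrary _ _ _ := ⟨Equiv.refl _, fun _ => rfl⟩
  hidesDemands _ _ _ _ _ := ⟨Equiv.refl _, fun _ => ⟨rfl, fun _ _ => rfl⟩⟩

section Parallel

variable {ι : Type} [Fintype ι] {Fs ms ns : ι → ℕ} {m n : ℕ}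

/-- Memory sharing: the files are cut into parts, each of which is treated by a separate scheme. -/
def parallel [DecidableEq ι] (S : ∀ i, CachingScheme N C r (Fs i) (ms i) (ns i))
    (posF : (Σ i, Fin (Fs i)) ≃ Fin F)
    (posm : (Σ i, Fin (ms i)) ≃ Fin m) (posn : (Σ i, Fin (ns i)) ≃ Fin n) :
    CachingScheme N C r F m n where
  Rand := ∀ i, (S i).Rand
  place c P W := assemble posm fun i => (S i).place c (P i) (restrict (fun b => posF ⟨i, b⟩) W)
  send P d W := assemble posn fun i => (S i).send (P i) d (restrict (fun b => posF ⟨i, b⟩) W)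

lemma IsPerfect.parallel [DecidableEq ι] {S : ∀ i, CachingScheme N C r (Fs i) (ms i) (ns i)}
    (hS : ∀ i, (S i).IsPerfect) (posF : (Σ i, Fin (Fs i)) ≃ Fin F)
    (posm : (Σ i, Fin (ms i)) ≃ Fin m) (posn : (Σ i, Fin (ns i)) ≃ Fin n) :
    (parallel S posF posm posn).IsPerfect where
  decodes g P P' d d' W W' hX hd hZ := by
    have part_eq : ∀ i, linComb (d g) (restrict (fun b => posF ⟨i, b⟩) W) =
        linComb (d' g) (restrict (fun b => posF ⟨i, b⟩) W') := fun i =>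
      (hS i).decodes g _ _ _ _ _ _ (congrFun ((assemble posn).injective hX) i) hd fun c hc =>
        congrFun ((assemble posm).injective (hZ c hc)) i
    simp only [linComb_restrict] at part_eq
    ext k
    obtain ⟨⟨i, b⟩, rfl⟩ := posF.surjective k
    exact congrFun (part_eq i) b
  hidesLibrary d W W' := by
    choose e he using fun i => (hS i).hidesLibrary d (restrict (fun b => posF ⟨i, b⟩) W)
      (restrict (fun b => posF ⟨i, b⟩) W')
    exact ⟨Equiv.piCongrRight e, fun P =>
      congrArg (assemble posn) (funext fun i => he i (P i))⟩
  hidesDemands g W d d' hd := by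
    choose e he using fun i => (hS i).hidesDemands g (restrict (fun b => posF ⟨i, b⟩) W) d d' hd
    exact ⟨Equiv.piCongrRight e, fun P =>
      ⟨congrArg (assemble posn) (funext fun i => (he i (P i)).1),
        fun c hc => congrArg (assemble posm) (funext fun i => (he i (P i)).2 c hc)⟩⟩

lemma exists_isPerfect_sum
    (h : ∀ i, ∃ S : CachingScheme N C r (Fs i) (ms i) (ns i), S.IsPerfect) :
    ∃ S : CachingScheme N C r (∑ i, Fs i) (∑ i, ms i) (∑ i, ns i), S.IsPerfect := by
  classical
  choose S hS using h
  exact ⟨_, IsPerfect.parallel hS (Fintype.equivFinOfCardEq (by simp))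
    (Fintype.equivFinOfCardEq (by simp)) (Fintype.equivFinOfCardEq (by simp))⟩

end Parallel

end CachingScheme

section SubfileAffine

variable {N F L s ℓ : ℕ} {σ τ : Type}

/-- The word of length `ℓ` obtained from a word of length `s` by appending zeros, or by cutting off
the end. -/
def pad (ℓ : ℕ) : (Fin s → ZMod 2) →ₗ[ZMod 2] (Fin ℓ → ZMod 2) where
  toFun v b := if h : b.1 < s then v ⟨b.1, h⟩ else 0
  map_add' v v' := by ext b; by_cases h : b.1 < s <;> simp [h]
  map_smul' c v := by ext b; by_cases h : b.1 < s <;> simp [h]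

lemma pad_apply (v : Fin s → ZMod 2) (b : Fin ℓ) :
    pad ℓ v b = if h : b.1 < s then v ⟨b.1, h⟩ else 0 := rfl

lemma pad_self (v : Fin s → ZMod 2) : pad s v = v := by
  ext b
  simp [pad_apply]

lemma pad_injective (h : s ≤ ℓ) : Function.Injective (pad (s := s) ℓ) := fun v v' hv => by
  ext b
  simpa [pad_apply] using congrFun hv (Fin.castLE h b)

/-- The word `f`, a function of some data `σ` and of the subfiles, is the sum of a key and of an
`𝔽₂`-linear combination of padded subfiles, both of which are determined by `σ`: the words that
schemes may use as blocks. -/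
def IsSubfileAffine [Fintype τ] (f : σ → (τ → Library N s) → Fin ℓ → ZMod 2) : Prop :=
  ∃ (key : σ → Fin ℓ → ZMod 2) (coef : σ → τ → Demand N),
    ∀ x w, f x w = key x + ∑ u, pad ℓ (linComb (coef x u) (w u))

namespace IsSubfileAffine

variable [Fintype τ]

lemma of_key (key : σ → Fin ℓ → ZMod 2) :
    IsSubfileAffine fun x (_ : τ → Library N s) => key x :=
  ⟨key, 0, fun x w => by simp [linComb_zero]⟩

lemma of_linComb (u : τ) (d : σ → Demand N) :
    IsSubfileAffine fun x (w : τ → Library N s) => linComb (d x) (w u) := by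
  classical
  refine ⟨0, fun x => Pi.single u (d x), fun x w => ?_⟩
  rw [Finset.sum_eq_single u (fun v _ hv => by simp [hv, linComb_zero]) (by simp)]
  simp [pad_self]

lemma of_subfile (u : τ) (i : Fin N) :
    IsSubfileAffine fun (_ : σ) (w : τ → Library N s) => w u i := by
  simpa only [linComb_single] using of_linComb (σ := σ) (s := s) u fun _ => Pi.single i 1

lemma add {f g : σ → (τ → Library N s) → Fin ℓ → ZMod 2} (hf : IsSubfileAffine f)
    (hg : IsSubfileAffine g) : IsSubfileAffine fun x w => f x w + g x w := by
  obtain ⟨kf, cf, hf⟩ := hf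
  obtain ⟨kg, cg, hg⟩ := hg
  refine ⟨fun x => kf x + kg x, fun x u => cf x u + cg x u, fun x w => ?_⟩
  simp only [hf, hg, linComb_add, map_add, Finset.sum_add_distrib]
  abel

lemma sum {ι : Type} (A : Finset ι) {f : ι → σ → (τ → Library N s) → Fin ℓ → ZMod 2}
    (hf : ∀ i ∈ A, IsSubfileAffine (f i)) : IsSubfileAffine fun x w => ∑ i ∈ A, f i x w := by
  classical
  induction A using Finset.induction_on with
  | empty => simpa using of_key 0
  | insert i A hi ih =>
    simp only [Finset.sum_insert hi]
    exact (hf i (Finset.mem_insert_self i A)).add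
      (ih fun j hj => hf j (Finset.mem_insert_of_mem hj))

lemma map_pad {f : σ → (τ → Library N s) → Fin s → ZMod 2} (hf : IsSubfileAffine f) (ℓ : ℕ) :
    IsSubfileAffine fun x w => pad ℓ (f x w) := by
  obtain ⟨key, coef, hf⟩ := hf
  exact ⟨fun x => pad ℓ (key x), coef, fun x w => by simp [hf, pad_self]⟩

end IsSubfileAffine

/-- The subfiles of a library, when `e` splits every file into subfiles of `s` bits. -/
def subfiles (e : τ × Fin s ≃ Fin F) (W : Library N F) (u : τ) : Library N s :=
  restrict (fun b => e (u, b)) W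

lemma operatesOnSubfiles_assemble {ι : Type} [Finite ι] [Fintype τ] {len : ι → ℕ}
    (pos : (Σ j, Fin (len j)) ≃ Fin ℓ) (eτ : τ ≃ Fin L) (e : Fin L × Fin s ≃ Fin F)
    {f : σ → (τ → Library N s) → (j : ι) → Fin (len j) → ZMod 2}
    (hf : ∀ j, IsSubfileAffine fun x w => f x w j) :
    OperatesOnSubfiles e fun x W =>
      assemble pos (f x (subfiles ((eτ.prodCongr (Equiv.refl _)).trans e) W)) := by
  simp only [IsSubfileAffine] at hf
  choose key coef hf using hf
  obtain ⟨J, ⟨eι⟩⟩ := Finite.exists_equiv_fin ι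
  refine ⟨J, fun j => len (eι.symm j),
    (Equiv.sigmaCongrLeft (β := fun j => Fin (len j)) eι.symm).trans pos,
    fun x j => key (eι.symm j) x, fun x j i u => coef (eι.symm j) x (eτ.symm u) i,
    fun x W j b => ?_⟩
  refine (assemble_apply pos _ (eι.symm j) b).trans ?_
  rw [hf, Pi.add_apply, Finset.sum_apply, Finset.sum_comm, ← Equiv.sum_comp eτ]
  refine congrArg _ (Finset.sum_congr rfl fun u _ => ?_)
  rw [pad_apply]
  split_ifs <;> simp [linComb_apply, subfiles, restrict]

end SubfileAffine

/-- A subfile of the coded scheme with parameter `t`, one for each `t`-subset of the caches; the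
caches in that subset store it. -/
abbrev Subfile (C t : ℕ) : Type := {T : Finset (Fin C) // T.card = t}

/-- The pairs of a user and a subfile that it cannot read from its caches. -/
abbrev Missing (C r t : ℕ) : Type := Σ g : User C r, {T : Subfile C t // Disjoint g.1 T.1}

section CodedScheme

variable {N C r t s : ℕ}

namespace Missing

/-- The index of the transmission that serves a missing subfile: the caches of the user and those
that store the subfile. -/
def transmission (x : Missing C r t) : Subfile C (t + r) :=
  ⟨x.1.1 ∪ x.2.1.1, by
    rw [Finset.card_union_of_disjoint x.2.2, x.1.2, x.2.1.2, add_comm]⟩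

/-- A transmission serves many users, but it involves only one subfile that a given user misses. -/
lemma eq_of_transmission_eq {x y : Missing C r t} (h : x.transmission = y.transmission)
    (hd : Disjoint x.1.1 y.2.1.1) : x = y := by
  have hunion : x.1.1 ⊔ x.2.1.1 = y.1.1 ⊔ y.2.1.1 := congrArg Subtype.val h
  have huser : x.1 = y.1 := Subtype.ext <| Finset.eq_of_subset_of_card_le
    (hd.left_le_of_le_sup_right (le_sup_left.trans hunion.le)) (by rw [x.1.2, y.1.2])
  have hsubfile : y.2.1 = x.2.1 := Subtype.ext <| Finset.eq_of_subset_of_card_le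
    (hd.symm.left_le_of_le_sup_left (le_sup_right.trans hunion.ge)) (by rw [x.2.1.2, y.2.1.2])
  obtain ⟨g, T, hT⟩ := x
  obtain ⟨g', T', hT'⟩ := y
  obtain rfl : g = g' := huser
  obtain rfl : T' = T := hsubfile
  rfl

end Missing

/-- The server's randomness: the masks of the transmissions, the random shares of the users' keys,
and the masks of the demands. -/
structure Keys (N C r t s : ℕ) where
  mask : Subfile C (t + r) → Fin s → ZMod 2
  share : Missing C r t → Fin C → Fin s → ZMod 2
  demandMask : User C r → Demand N

namespace Keys

noncomputable instance : Fintype (Keys N C r t s) :=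
  Fintype.ofInjective (fun P => (P.mask, P.share, P.demandMask)) fun ⟨_, _, _⟩ ⟨_, _, _⟩ h => by
    simpa only [Prod.mk.injEq, Keys.mk.injEq] using h

instance : Nonempty (Keys N C r t s) := ⟨⟨0, 0, 0⟩⟩

/-- Shifts the shares and the masks of the demands by constants, and the masks of the transmissions
by an amount that depends on the masks of the demands. -/
def shift (f : (User C r → Demand N) → Subfile C (t + r) → Fin s → ZMod 2)
    (y : Missing C r t → Fin C → Fin s → ZMod 2) (δ : User C r → Demand N) :
    Equiv.Perm (Keys N C r t s) where
  toFun P := ⟨P.mask + f P.demandMask, P.share + y, P.demandMask + δ⟩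
  invFun P := ⟨P.mask - f (P.demandMask - δ), P.share - y, P.demandMask - δ⟩
  left_inv P := by simp
  right_inv P := by simp

lemma shift_apply (f : (User C r → Demand N) → Subfile C (t + r) → Fin s → ZMod 2)
    (y : Missing C r t → Fin C → Fin s → ZMod 2) (δ : User C r → Demand N) (P : Keys N C r t s) :
    shift f y δ P = ⟨P.mask + f P.demandMask, P.share + y, P.demandMask + δ⟩ := rfl

end Keys

/-- The sum of the subfiles combined with the coefficients `q` that is sent, masked, with index
`A`. -/
def codedSum (q : User C r → Demand N) (w : Subfile C t → Library N s) (A : Subfile C (t + r)) :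
    Fin s → ZMod 2 :=
  ∑ x : Missing C r t with x.transmission = A, linComb (q x.1) (w x.2.1)

/-- The transmission with index `A`. The demands `d` enter only through the masked demands, which
are sent as well. -/
def transmit (P : Keys N C r t s) (d : User C r → Demand N) (w : Subfile C t → Library N s)
    (A : Subfile C (t + r)) : Fin s → ZMod 2 :=
  P.mask A + codedSum (P.demandMask + d) w A

/-- What the user `x.1` must subtract from a transmission, besides subfiles that it can read, to
obtain its linear combination of the missing subfile `x.2`. -/
def userKey (P : Keys N C r t s) (w : Subfile C t → Library N s) (x : Missing C r t) :
    Fin s → ZMod 2 :=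
  P.mask x.transmission + linComb (P.demandMask x.1) (w x.2.1)

/-- The share of the cache `c` of a key of the user `x.1`. All shares are random, except that of the
cache `a x.1`, which is chosen such that the shares of the caches of the user sum up to the key. -/
def keyShare (a : User C r → Fin C) (P : Keys N C r t s) (w : Subfile C t → Library N s)
    (x : Missing C r t) (c : Fin C) : Fin s → ZMod 2 :=
  if c = a x.1 then userKey P w x - ∑ c' ∈ x.1.1.erase c, P.share x c' else P.share x c

/-- The contribution to a transmission of the subfiles other than the one that the user misses. -/
def interference (q : User C r → Demand N) (w : Subfile C t → Library N s) (x : Missing C r t) :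
    Fin s → ZMod 2 :=
  ∑ y ∈ ({y | y.transmission = x.transmission} : Finset (Missing C r t)).erase x,
    linComb (q y.1) (w y.2.1)

lemma sum_keyShare {a : User C r → Fin C} (ha : ∀ g, a g ∈ g.1) (P : Keys N C r t s)
    (w : Subfile C t → Library N s) (x : Missing C r t) :
    ∑ c ∈ x.1.1, keyShare a P w x c = userKey P w x := by
  have random : ∀ c ∈ x.1.1.erase (a x.1), keyShare a P w x c = P.share x c := fun c hc =>
    if_neg (Finset.ne_of_mem_erase hc)
  rw [← Finset.add_sum_erase _ _ (ha x.1), Finset.sum_congr rfl random, keyShare, if_pos rfl,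
    sub_add_cancel]

lemma transmit_sub_userKey (P : Keys N C r t s) (d : User C r → Demand N)
    (w : Subfile C t → Library N s) (x : Missing C r t) :
    transmit P d w x.transmission - userKey P w x =
      linComb (d x.1) (w x.2.1) + interference (P.demandMask + d) w x := by
  have hx : x ∈ ({y | y.transmission = x.transmission} : Finset (Missing C r t)) := by simp
  rw [transmit, codedSum, ← Finset.add_sum_erase _ _ hx, userKey, interference, Pi.add_apply,
    linComb_add]
  abel

lemma interference_congr (q : User C r → Demand N) {w w' : Subfile C t → Library N s}
    {x : Missing C r t} (h : ∀ T : Subfile C t, ¬ Disjoint x.1.1 T.1 → w T = w' T) :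
    interference q w x = interference q w' x := by
  refine Finset.sum_congr rfl fun y hy => ?_
  simp only [Finset.mem_erase, Finset.mem_filter_univ] at hy
  obtain ⟨hne, hxy⟩ := hy
  rw [h y.2.1 fun hd => hne (Missing.eq_of_transmission_eq hxy.symm hd).symm]

lemma linComb_eq_of_observed {a : User C r → Fin C} (ha : ∀ g, a g ∈ g.1) {P P' : Keys N C r t s}
    {d d' : User C r → Demand N} {w w' : Subfile C t → Library N s} {g : User C r}
    (hd : d g = d' g) (masked : P.demandMask + d = P'.demandMask + d')
    (transmissions : ∀ A, transmit P d w A = transmit P' d' w' A)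
    (readable : ∀ T : Subfile C t, ¬ Disjoint g.1 T.1 → w T = w' T)
    (shares : ∀ x : Missing C r t, x.1 = g → ∀ c ∈ g.1, keyShare a P w x c = keyShare a P' w' x c)
    (T : Subfile C t) : linComb (d g) (w T) = linComb (d' g) (w' T) := by
  by_cases hT : Disjoint g.1 T.1
  · let x : Missing C r t := ⟨g, T, hT⟩
    have key : userKey P w x = userKey P' w' x := by
      rw [← sum_keyShare ha, ← sum_keyShare ha, Finset.sum_congr rfl (shares x rfl)]
    have h := transmit_sub_userKey P d w x
    rw [transmissions, key, transmit_sub_userKey, masked,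
      interference_congr (x := x) _ readable] at h
    exact (add_right_cancel h).symm
  · rw [hd, readable T hT]

/-- The keys of users other than `g` change with the masks of their demands. Each such user reads a
cache that `g` does not read, whose share absorbs the change. -/
lemma exists_keyShare_shift_eq (a : User C r → Fin C) (g : User C r)
    (w : Subfile C t → Library N s) (δ : User C r → Demand N) (hδ : δ g = 0) :
    ∃ y, ∀ (P : Keys N C r t s) (x : Missing C r t), ∀ c ∈ g.1,
      keyShare a (Keys.shift 0 y δ P) w x c = keyShare a P w x c := by
  have unread : ∀ h : User C r, h ≠ g → ∃ c ∈ h.1, c ∉ g.1 := fun h hne =>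
    Finset.not_subset.1 fun hsub =>
      hne (Subtype.ext (Finset.eq_of_subset_of_card_le hsub (by rw [h.2, g.2])))
  have : Nonempty (Fin C) := ⟨a g⟩
  choose! o mem_o o_notMem using unread
  refine ⟨fun x => Pi.single (o x.1) (linComb (δ x.1) (w x.2.1)), fun P x c hc => ?_⟩
  rcases eq_or_ne x.1 g with hx | hx
  · simp [keyShare, Keys.shift_apply, userKey, hx, hδ, linComb_zero]
  have ho : o x.1 ≠ c := fun h => o_notMem _ hx (h ▸ hc)
  by_cases hca : c = a x.1
  · have mem_erase : o x.1 ∈ x.1.1.erase c := Finset.mem_erase.2 ⟨ho, mem_o _ hx⟩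
    have absorbed : ∑ c' ∈ x.1.1.erase c, Pi.single (M := fun _ => Fin s → ZMod 2) (o x.1)
        (linComb (δ x.1) (w x.2.1)) c' = linComb (δ x.1) (w x.2.1) := by
      rw [Finset.sum_pi_single', if_pos mem_erase]
    simp only [keyShare, if_pos hca, Keys.shift_apply, userKey, Pi.zero_apply, Pi.add_apply,
      linComb_add, Finset.sum_add_distrib, absorbed, add_zero]
    abel
  · simp [keyShare, hca, Keys.shift_apply, ho.symm]

/-- A block of the cache `c`: a subfile that it stores, or its share of a key of a user. -/
abbrev CacheBlock (N r t : ℕ) {C : ℕ} (c : Fin C) : Type :=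
  ({T : Subfile C t // c ∈ T.1} × Fin N) ⊕ {x : Missing C r t // c ∈ x.1.1}

/-- The length of the blocks of a cache. The shares are padded from `s` to `s'` bits, because the
memory in the theorem is that of keys over a field of `2 ^ l` elements. -/
def cacheBlockLength (N r t s s' : ℕ) {C : ℕ} (c : Fin C) : CacheBlock N r t c → ℕ :=
  Sum.elim (fun _ => s) fun _ => s'

/-- A block of the message: a transmission, or the masked demand of a user. -/
abbrev MessageBlock (C r t : ℕ) : Type := Subfile C (t + r) ⊕ User C r

/-- The length of the blocks of the message. -/
def messageBlockLength (N C r t s : ℕ) : MessageBlock C r t → ℕ :=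
  Sum.elim (fun _ => s) fun _ => N

/-- The contents of a cache, as a family of blocks. -/
def cacheBlocks (s' : ℕ) (a : User C r → Fin C) (P : Keys N C r t s)
    (w : Subfile C t → Library N s) (c : Fin C) :
    ∀ j : CacheBlock N r t c, Fin (cacheBlockLength N r t s s' c j) → ZMod 2
  | .inl (T, i) => w T.1 i
  | .inr x => pad s' (keyShare a P w x.1 c)

/-- The broadcast message, as a family of blocks. -/
def messageBlocks (P : Keys N C r t s) (d : User C r → Demand N) (w : Subfile C t → Library N s) :
    ∀ j : MessageBlock C r t, Fin (messageBlockLength N C r t s j) → ZMod 2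
  | .inl A => transmit P d w A
  | .inr g => P.demandMask g + d g

lemma messageBlocks_eq_iff {P P' : Keys N C r t s} {d d' : User C r → Demand N}
    {w w' : Subfile C t → Library N s} : messageBlocks P d w = messageBlocks P' d' w' ↔
      (∀ A, transmit P d w A = transmit P' d' w' A) ∧
        P.demandMask + d = P'.demandMask + d' := by
  refine ⟨fun h => ⟨fun A => congrFun h (.inl A), funext fun g => congrFun h (.inr g)⟩, ?_⟩
  rintro ⟨transmissions, masked⟩
  funext j
  rcases j with A | g
  · exact transmissions A
  · exact congrFun masked g

lemma exists_messageBlocks_shift_eq (d : User C r → Demand N)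
    (w w' : Subfile C t → Library N s) :
    ∃ f, ∀ P, messageBlocks (Keys.shift f 0 0 P) d w' = messageBlocks P d w := by
  refine ⟨fun q A => codedSum (q + d) w A - codedSum (q + d) w' A, fun P =>
    messageBlocks_eq_iff.2 ⟨fun A => ?_, by simp [Keys.shift_apply]⟩⟩
  simp only [transmit, Keys.shift_apply, Pi.add_apply, add_zero]
  abel

lemma messageBlocks_shift_sub (y : Missing C r t → Fin C → Fin s → ZMod 2) (P : Keys N C r t s)
    (d d' : User C r → Demand N) (w : Subfile C t → Library N s) :
    messageBlocks (Keys.shift 0 y (d - d') P) d' w = messageBlocks P d w := by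
  refine messageBlocks_eq_iff.2 ⟨fun A => ?_, ?_⟩ <;>
    simp [transmit, Keys.shift_apply, add_assoc]

section SubfileAffine

variable {σ : Type} (P : σ → Keys N C r t s)

lemma isSubfileAffine_userKey (x : Missing C r t) :
    IsSubfileAffine fun z w => userKey (P z) w x :=
  (IsSubfileAffine.of_key fun z => (P z).mask x.transmission).add
    (IsSubfileAffine.of_linComb x.2.1 fun z => (P z).demandMask x.1)

lemma isSubfileAffine_keyShare (a : User C r → Fin C) (x : Missing C r t) (c : Fin C) :
    IsSubfileAffine fun z w => keyShare a (P z) w x c := by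
  unfold keyShare
  split_ifs
  · simp only [sub_eq_add_neg]
    exact (isSubfileAffine_userKey P x).add
      (IsSubfileAffine.of_key fun z => -∑ c' ∈ x.1.1.erase c, (P z).share x c')
  · exact IsSubfileAffine.of_key fun z => (P z).share x c

lemma isSubfileAffine_cacheBlocks (s' : ℕ) (a : User C r → Fin C) (c : Fin C)
    (j : CacheBlock N r t c) : IsSubfileAffine fun z w => cacheBlocks s' a (P z) w c j := by
  rcases j with ⟨T, i⟩ | x
  · exact IsSubfileAffine.of_subfile T.1 i
  · exact (isSubfileAffine_keyShare P a x.1 c).map_pad s'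

lemma isSubfileAffine_messageBlocks (d : σ → User C r → Demand N) (j : MessageBlock C r t) :
    IsSubfileAffine fun z w => messageBlocks (P z) (d z) w j := by
  rcases j with A | g
  · exact (IsSubfileAffine.of_key fun z => (P z).mask A).add
      (IsSubfileAffine.sum _ fun x _ =>
        IsSubfileAffine.of_linComb x.2.1 fun z => (P z).demandMask x.1 + d z x.1)
  · exact IsSubfileAffine.of_key fun z => (P z).demandMask g + d z g

end SubfileAffine

variable {F m n s' : ℕ} (a : User C r → Fin C) (e : Subfile C t × Fin s ≃ Fin F)
  (posCache : ∀ c : Fin C, (Σ j, Fin (cacheBlockLength N r t s s' c j)) ≃ Fin m)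
  (posMessage : (Σ j, Fin (messageBlockLength N C r t s j)) ≃ Fin n)

/-- The coded scheme with parameter `t`: `e` splits the files into subfiles, and `a g` is the cache
whose shares of the keys of the user `g` are determined by the other shares. -/
noncomputable def codedScheme : CachingScheme N C r F m n where
  Rand := Keys N C r t s
  place c P W := assemble (posCache c) (cacheBlocks s' a P (subfiles e W) c)
  send P d W := assemble posMessage (messageBlocks P d (subfiles e W))

namespace CachingScheme

lemma isPerfect_codedScheme (hs : s ≤ s') (ha : ∀ g, a g ∈ g.1) :
    (codedScheme a e posCache posMessage).IsPerfect where
  decodes g P P' d d' W W' hX hd hZ := by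
    obtain ⟨transmissions, masked⟩ := messageBlocks_eq_iff.1 ((assemble posMessage).injective hX)
    have cached := fun c hc => congrFun ((assemble (posCache c)).injective (hZ c hc))
    have readable : ∀ T : Subfile C t, ¬ Disjoint g.1 T.1 → subfiles e W T = subfiles e W' T := by
      intro T hT
      obtain ⟨c, hcg, hcT⟩ := Finset.not_disjoint_iff.1 hT
      exact funext fun i => cached c hcg (.inl (⟨T, hcT⟩, i))
    have shares : ∀ x : Missing C r t, x.1 = g → ∀ c ∈ g.1,
        keyShare a P (subfiles e W) x c = keyShare a P' (subfiles e W') x c := by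
      rintro x rfl c hc
      exact pad_injective hs (cached c hc (.inr ⟨x, hc⟩))
    have wanted := linComb_eq_of_observed ha hd masked transmissions readable shares
    simp only [subfiles, linComb_restrict] at wanted
    ext k
    obtain ⟨⟨T, b⟩, rfl⟩ := e.surjective k
    exact congrFun (wanted T) b
  hidesLibrary d W W' := by
    obtain ⟨f, hf⟩ := exists_messageBlocks_shift_eq d (subfiles e W) (subfiles e W')
    exact ⟨Keys.shift f 0 0, fun P => congrArg (assemble posMessage) (hf P)⟩
  hidesDemands g W d d' hd := by
    obtain ⟨y, hy⟩ := exists_keyShare_shift_eq a g (subfiles e W) (d - d') (by simp [hd])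
    refine ⟨Keys.shift 0 y (d - d'), fun P =>
      ⟨congrArg (assemble posMessage) (messageBlocks_shift_sub y P d d' (subfiles e W)),
        fun c hc => congrArg (assemble (posCache c)) (funext fun j => ?_)⟩⟩
    rcases j with ⟨T, i⟩ | x
    · rfl
    · exact congrArg (pad s') (hy P x.1 c hc)

lemma hasSubpacketization_codedScheme {L : ℕ} (eτ : Subfile C t ≃ Fin L)
    (e : Fin L × Fin s ≃ Fin F) :
    (codedScheme a ((eτ.prodCongr (Equiv.refl _)).trans e) posCache
      posMessage).HasSubpacketization L := by
  refine ⟨s, e, fun c => ?_, ?_⟩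
  · exact operatesOnSubfiles_assemble (σ := Keys N C r t s)
      (f := fun P w => cacheBlocks s' a P w c) (posCache c) eτ e
      (isSubfileAffine_cacheBlocks id s' a c)
  · exact operatesOnSubfiles_assemble (σ := Keys N C r t s × (User C r → Demand N))
      (f := fun x w => messageBlocks x.1 x.2 w) posMessage eτ e
      (isSubfileAffine_messageBlocks Prod.fst Prod.snd)

end CachingScheme

end CodedScheme

section Cardinalities

variable {C : ℕ}

lemma card_subfile_disjoint (t : ℕ) (A : Finset (Fin C)) :
    Fintype.card {T : Subfile C t // Disjoint A T.1} = (C - A.card).choose t := by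
  have e : {T : Subfile C t // Disjoint A T.1} ≃ Finset.powersetCard t Aᶜ :=
    (Equiv.subtypeSubtypeEquivSubtypeInter _ fun T => Disjoint A T).trans
      (Equiv.subtypeEquivRight fun T => by
        rw [Finset.mem_powersetCard, Finset.subset_compl_iff_disjoint_left, and_comm])
  rw [Fintype.card_congr e, Fintype.card_coe, Finset.card_powersetCard, Finset.card_compl,
    Fintype.card_fin]

lemma card_subfile_mem (t : ℕ) (c : Fin C) :
    Fintype.card {T : Subfile C t // c ∈ T.1} = C.choose t - (C - 1).choose t := by
  have avoiding := card_subfile_disjoint t {c}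
  simp only [Finset.disjoint_singleton_left, Finset.card_singleton] at avoiding
  have compl := Fintype.card_subtype_compl fun T : Subfile C t => c ∈ T.1
  have le := Fintype.card_subtype_le fun T : Subfile C t => c ∈ T.1
  rw [Fintype.card_finset_len, Fintype.card_fin] at compl le
  omega

lemma card_user_mem {r : ℕ} (hr : 1 ≤ r) (c : Fin C) :
    Fintype.card {g : User C r // c ∈ g.1} = (C - 1).choose (r - 1) := by
  obtain ⟨k, rfl⟩ := Nat.exists_eq_add_of_le' hr
  obtain ⟨n, rfl⟩ := Nat.exists_eq_add_of_le' c.pos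
  rw [card_subfile_mem, Nat.choose_succ_succ]
  simp

lemma card_missing_mem {r : ℕ} (hr : 1 ≤ r) (t : ℕ) (c : Fin C) :
    Fintype.card {x : Missing C r t // c ∈ x.1.1} =
      (C - r).choose t * (C - 1).choose (r - 1) := by
  rw [Fintype.card_congr (Equiv.subtypeSigmaEquiv _ fun g : User C r => c ∈ g.1),
    Fintype.card_sigma,
    Finset.sum_congr rfl fun g _ => (card_subfile_disjoint t g.1.1).trans (by rw [g.1.2]),
    Finset.sum_const, Finset.card_univ, card_user_mem hr, smul_eq_mul, mul_comm]

end Cardinalities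

/-- The number of bits of each cache of the coded scheme with parameter `t`, for subfiles of `s`
bits and key shares that are padded to `s'` bits. -/
def codedCacheSize (N C r t s s' : ℕ) : ℕ :=
  (C.choose t - (C - 1).choose t) * N * s + (C - r).choose t * (C - 1).choose (r - 1) * s'

namespace CachingScheme

lemma exists_codedScheme {N C r : ℕ} (hr : 1 ≤ r) (t : ℕ) {s s' : ℕ} (hs : s ≤ s') :
    ∃ S : CachingScheme N C r (C.choose t * s) (codedCacheSize N C r t s s')
      (C.choose (t + r) * s + C.choose r * N),
      S.IsPerfect ∧ S.HasSubpacketization (C.choose t) := by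
  have nonempty : ∀ g : User C r, ∃ c, c ∈ g.1 := fun g => Finset.card_pos.1 (by rw [g.2]; exact hr)
  choose a ha using nonempty
  have posCache : ∀ c : Fin C, (Σ j, Fin (cacheBlockLength N r t s s' c j)) ≃
      Fin (codedCacheSize N C r t s s') := fun c => Fintype.equivFinOfCardEq (by
    simp only [Fintype.card_sigma, Fintype.card_fin, Fintype.sum_sum_type]
    simp [cacheBlockLength, codedCacheSize, card_subfile_mem, card_missing_mem hr])
  have posMessage : (Σ j, Fin (messageBlockLength N C r t s j)) ≃
      Fin (C.choose (t + r) * s + C.choose r * N) := Fintype.equivFinOfCardEq (by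
    simp only [Fintype.card_sigma, Fintype.card_fin, Fintype.sum_sum_type]
    simp [messageBlockLength])
  have eτ : Subfile C t ≃ Fin (C.choose t) := Fintype.equivFinOfCardEq (by simp)
  exact ⟨_, isPerfect_codedScheme a _ posCache posMessage hs ha,
    hasSubpacketization_codedScheme a posCache posMessage eτ finProdFinEquiv⟩

end CachingScheme

section MemoryAndRate

variable {N C r t s : ℕ}

lemma fieldDegree_pos (r : ℕ) : 0 < fieldDegree r :=
  (Nat.sInf_mem (s := {l : ℕ | 0 < l ∧ r < 2 ^ l}) ⟨r + 1, r.succ_pos,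
    Nat.lt_two_pow_self.trans (Nat.pow_lt_pow_right one_lt_two r.lt_succ_self)⟩).1

lemma cast_choose_sub_choose_pred (hC : 0 < C) (ht : t ≤ C) :
    ((C.choose t - (C - 1).choose t : ℕ) : ℝ) = C.choose t * t / C := by
  obtain ⟨n, rfl⟩ := Nat.exists_eq_add_of_le' hC
  have h := congrArg (Nat.cast (R := ℝ)) (Nat.choose_mul_succ_eq n t)
  push_cast [Nat.cast_sub ht] at h
  rw [Nat.add_sub_cancel, Nat.cast_sub (Nat.choose_le_choose t n.le_succ),
    eq_div_iff (by positivity)]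
  push_cast
  linear_combination -h

lemma cast_codedCacheSize (hC : 0 < C) (ht : t ≤ C) (s' : ℕ) :
    (codedCacheSize N C r t s s' : ℝ) =
      N * t / C * (C.choose t * s) + (C - r).choose t * (C - 1).choose (r - 1) * s' := by
  rw [codedCacheSize]
  push_cast
  rw [cast_choose_sub_choose_pred hC ht]
  ring

lemma rateSP_mul (ht : t ≤ C) : rateSP C r t * (C.choose t * s) = C.choose (t + r) * s := by
  have : (C.choose t : ℝ) ≠ 0 := by exact_mod_cast (Nat.choose_pos ht).ne'
  rw [rateSP]
  field_simp

lemma memorySP_mul (hC : 0 < C) (ht : t ≤ C) (hs : 0 < s) :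
    memorySP N C r (C.choose t * s) t * (C.choose t * s) =
      codedCacheSize N C r t s (⌈(s : ℝ) / fieldDegree r⌉₊ * fieldDegree r) := by
  have hL : (C.choose t : ℝ) ≠ 0 := by exact_mod_cast (Nat.choose_pos ht).ne'
  have hs' : (s : ℝ) ≠ 0 := by exact_mod_cast hs.ne'
  have hdiv : ((C.choose t * s : ℕ) : ℝ) / (fieldDegree r * C.choose t) = s / fieldDegree r := by
    push_cast
    rw [mul_comm (fieldDegree r : ℝ), mul_div_mul_left _ _ hL]
  rw [cast_codedCacheSize hC ht, memorySP, hdiv, add_mul]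
  push_cast
  field_simp

lemma codedCacheSize_le_memorySP_mul {F : ℕ} (hC : 0 < C) (ht : t ≤ C) (hF : 0 < F) :
    (codedCacheSize N C r t s s : ℝ) ≤ memorySP N C r F t * (C.choose t * s) := by
  have hL : (0 : ℝ) < C.choose t := by exact_mod_cast Nat.choose_pos ht
  have : (0 : ℝ) < F := by exact_mod_cast hF
  have hl : (0 : ℝ) < fieldDegree r := by exact_mod_cast fieldDegree_pos r
  rw [cast_codedCacheSize hC ht, memorySP, add_mul, mul_assoc (_ * _ : ℝ) (Nat.cast ⌈_⌉₊),
    mul_assoc (_ * _ : ℝ)]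
  gcongr
  calc (s : ℝ) = F / (fieldDegree r * C.choose t) * (fieldDegree r / F) * (C.choose t * s) := by
        field_simp
    _ ≤ _ := by gcongr; exact Nat.le_ceil _

lemma le_ceil_div_mul {l : ℕ} (hl : 0 < l) (s : ℕ) : s ≤ ⌈(s : ℝ) / l⌉₊ * l := by
  have h := (div_le_iff₀ (by exact_mod_cast hl)).1 (Nat.le_ceil ((s : ℝ) / l))
  exact_mod_cast h

lemma rateSP_nonneg (C r t : ℕ) : 0 ≤ rateSP C r t := by
  unfold rateSP
  positivity

lemma rateSP_le (ht : t ≤ C) : rateSP C r t ≤ 2 ^ C :=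
  (div_le_self (Nat.cast_nonneg _) (by exact_mod_cast Nat.choose_pos ht)).trans
    (by exact_mod_cast Nat.choose_le_two_pow C (t + r))

lemma memorySP_self (hr : 1 ≤ r) (hC : 0 < C) (F : ℕ) : memorySP N C r F C = N := by
  have hC' : (C : ℝ) ≠ 0 := by exact_mod_cast hC.ne'
  simp [memorySP, Nat.choose_eq_zero_of_lt (show C - r < C by omega), hC']

lemma rateSP_self (hr : 1 ≤ r) : rateSP C r C = 0 := by
  simp [rateSP, Nat.choose_eq_zero_of_lt (show C < C + r by omega)]

end MemoryAndRate

/-- All weights are rounded down, and what is left goes to a point where `μ` is smallest. -/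
lemma exists_rounded_weights {ι : Type*} [Fintype ι] [Nonempty ι] {w : ι → ℝ} (hw : ∀ i, 0 ≤ w i)
    (hw1 : ∑ i, w i = 1) (μ : ι → ℝ) (Q : ℕ) :
    ∃ k : ι → ℕ, ∑ i, k i = Q ∧ ∑ i, μ i * k i ≤ (∑ i, w i * μ i) * Q ∧
      ∀ i, (k i : ℝ) ≤ w i * Q + Fintype.card ι := by
  classical
  obtain ⟨i₀, hi₀⟩ := Finite.exists_min μ
  have floor_le : ∀ i, (⌊w i * Q⌋₊ : ℝ) ≤ w i * Q := fun i =>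
    Nat.floor_le (mul_nonneg (hw i) Q.cast_nonneg)
  have sum_mul : ∑ i, w i * Q = (Q : ℝ) := by rw [← Finset.sum_mul, hw1, one_mul]
  have sum_floor_le : ∑ i, ⌊w i * Q⌋₊ ≤ Q := by
    exact_mod_cast (Finset.sum_le_sum fun i _ => floor_le i).trans_eq sum_mul
  obtain ⟨δ, hδ⟩ := Nat.exists_eq_add_of_le sum_floor_le
  have cast_δ : (δ : ℝ) = ∑ i, (w i * Q - ⌊w i * Q⌋₊) := by
    rw [Finset.sum_sub_distrib, sum_mul, eq_sub_iff_add_eq']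
    exact_mod_cast hδ.symm
  have δ_le : (δ : ℝ) ≤ Fintype.card ι := by
    have frac_le : ∀ i ∈ Finset.univ, w i * Q - ⌊w i * Q⌋₊ ≤ 1 := fun i _ => by
      linarith [Nat.lt_floor_add_one (w i * Q)]
    simpa [cast_δ] using Finset.sum_le_card_nsmul _ _ _ frac_le
  refine ⟨fun i => ⌊w i * Q⌋₊ + if i = i₀ then δ else 0, ?_, ?_, fun i => ?_⟩
  · simp [Finset.sum_add_distrib, ← hδ]
  · calc ∑ i, μ i * (⌊w i * Q⌋₊ + if i = i₀ then δ else 0 : ℕ)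
        = ∑ i, (μ i * ⌊w i * Q⌋₊ + μ i₀ * (w i * Q - ⌊w i * Q⌋₊)) := by
          simp [mul_add, Finset.sum_add_distrib, ← Finset.mul_sum, ← cast_δ]
      _ ≤ ∑ i, w i * μ i * Q := Finset.sum_le_sum fun i _ => by
          nlinarith [mul_nonneg (sub_nonneg.2 (hi₀ i)) (sub_nonneg.2 (floor_le i))]
      _ = (∑ i, w i * μ i) * Q := (Finset.sum_mul _ _ _).symm
  · push_cast
    refine add_le_add (floor_le i) ?_
    split_ifs
    exacts [δ_le, by positivity]

/-- A perfect scheme for files of `F` bits achieves the memory `p.1` and, up to `κ` bits, the rate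
`p.2`. -/
def Achievable (N C r F : ℕ) (κ : ℝ) (p : ℝ × ℝ) : Prop :=
  ∃ m n : ℕ, (m : ℝ) ≤ p.1 * F ∧ (n : ℝ) ≤ p.2 * F + κ ∧
    ∃ S : CachingScheme N C r F m n, S.IsPerfect

namespace Achievable

variable {N C r : ℕ} {κ : ℝ}

lemma mono {F : ℕ} {κ' : ℝ} {p : ℝ × ℝ} (h : Achievable N C r F κ p) (hκ : κ ≤ κ') :
    Achievable N C r F κ' p := by
  obtain ⟨m, n, hm, hn, hS⟩ := h
  exact ⟨m, n, hm, by linarith, hS⟩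

lemma sum_smul {ι : Type} [Fintype ι] [Nonempty ι] {D : ℕ} {ρ : ℝ} {w : ι → ℝ} {v : ι → ℝ × ℝ}
    (hw : ∀ i, 0 ≤ w i) (hw1 : ∑ i, w i = 1) (rate_nonneg : ∀ i, 0 ≤ (v i).2)
    (rate_le : ∀ i, (v i).2 ≤ ρ) (h : ∀ i k, Achievable N C r (D * k) κ (v i)) (Q : ℕ) :
    Achievable N C r (D * Q) (Fintype.card ι * (D * (Fintype.card ι * ρ) + κ))
      (∑ i, w i • v i) := by
  obtain ⟨k, hk, memory_le, k_le⟩ := exists_rounded_weights hw hw1 (fun i => (v i).1) Q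
  choose m n hm hn hS using fun i => h i (k i)
  have hS := CachingScheme.exists_isPerfect_sum hS
  rw [← Finset.mul_sum, hk] at hS
  refine ⟨_, _, ?_, ?_, hS⟩
  · push_cast [Prod.fst_sum, Prod.smul_fst, smul_eq_mul]
    calc ∑ i, (m i : ℝ) ≤ ∑ i, D * ((v i).1 * k i) := Finset.sum_le_sum fun i _ =>
          (hm i).trans_eq (by push_cast; ring)
      _ ≤ D * ((∑ i, w i * (v i).1) * Q) := by rw [← Finset.mul_sum]; gcongr
      _ = (∑ i, w i * (v i).1) * (D * Q) := by ring
  · push_cast [Prod.snd_sum, Prod.smul_snd, smul_eq_mul]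
    have part_le : ∀ i, (n i : ℝ) ≤
        w i * (v i).2 * (D * Q) + (D * (Fintype.card ι * ρ) + κ) := fun i => by
      calc (n i : ℝ) ≤ D * ((v i).2 * k i) + κ := (hn i).trans_eq (by push_cast; ring)
        _ ≤ D * ((v i).2 * (w i * Q + Fintype.card ι)) + κ := by
          have := rate_nonneg i
          gcongr
          exact k_le i
        _ = w i * (v i).2 * (D * Q) + (D * (Fintype.card ι * (v i).2) + κ) := by ring
        _ ≤ _ := by gcongr; exact rate_le i
    refine (Finset.sum_le_sum fun i _ => part_le i).trans_eq ?_
    rw [Finset.sum_add_distrib, ← Finset.sum_mul, Finset.sum_const, nsmul_eq_mul, Finset.card_univ]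

/-- By Carathéodory's theorem, memory sharing between at most three points suffices. -/
lemma of_mem_convexHull {A : Set (ℝ × ℝ)} {D : ℕ} {ρ : ℝ} (hκ : 0 ≤ κ)
    (rate_nonneg : ∀ p ∈ A, 0 ≤ p.2) (rate_le : ∀ p ∈ A, p.2 ≤ ρ)
    (h : ∀ p ∈ A, ∀ k, Achievable N C r (D * k) κ p) {p : ℝ × ℝ} (hp : p ∈ convexHull ℝ A)
    (Q : ℕ) : Achievable N C r (D * Q) (3 * (D * (3 * ρ) + κ)) p := by
  obtain ⟨ι, _, z, w, hz, independent, hw, hw1, rfl⟩ := eq_pos_convex_span_of_mem_convexHull hp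
  have hz : ∀ i, z i ∈ A := fun i => hz ⟨i, rfl⟩
  have card_le : (Fintype.card ι : ℝ) ≤ 3 := by
    have finrank_eq : Module.finrank ℝ (ℝ × ℝ) = 2 := by simp
    exact_mod_cast independent.card_le_finrank_succ.trans
      (Nat.succ_le_succ ((Submodule.finrank_le _).trans_eq finrank_eq))
  have : Nonempty ι := by
    by_contra! hι
    simp at hw1
  have hρ : 0 ≤ ρ :=
    let i := Classical.arbitrary ι
    (rate_nonneg _ (hz i)).trans (rate_le _ (hz i))
  refine (sum_smul (fun i => (hw i).le) hw1 (fun i => rate_nonneg _ (hz i))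
    (fun i => rate_le _ (hz i)) (fun i => h _ (hz i)) Q).mono ?_
  gcongr

end Achievable

/-- The memory-rate pair of the coded scheme with parameter `t`, for files of `F` bits. -/
noncomputable def memoryRatePoint (N C r F t : ℕ) : ℝ × ℝ :=
  (memorySP N C r F t, rateSP C r t)

section Points

variable {N C r : ℕ}

lemma pointsSP_subset_image (hr : 1 ≤ r) (hC : 0 < C) (F : ℕ)
    (hF : ∀ t ≤ C - r, C.choose t ∣ F) :
    pointsSP N C r F ⊆ memoryRatePoint N C r F '' {t | t ≤ C ∧ C.choose t ∣ F} := by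
  rintro p (⟨t, ht, rfl⟩ | rfl)
  · exact ⟨t, ⟨ht.trans (Nat.sub_le C r), hF t ht⟩, rfl⟩
  · exact ⟨C, ⟨le_rfl, by simp⟩, Prod.ext (memorySP_self hr hC F) (rateSP_self hr)⟩

lemma achievable_memoryRatePoint (hr : 1 ≤ r) (hC : 0 < C) {t F F' : ℕ} (ht : t ≤ C)
    (hF : C.choose t ∣ F) (hF' : 0 < F') :
    Achievable N C r F (C.choose r * N) (memoryRatePoint N C r F' t) := by
  obtain ⟨s, rfl⟩ := hF
  obtain ⟨S, hS, -⟩ := CachingScheme.exists_codedScheme (N := N) hr t le_rfl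
  refine ⟨_, _, ?_, ?_, S, hS⟩ <;> push_cast
  · exact codedCacheSize_le_memorySP_mul hC ht hF'
  · exact (congrArg (· + _) (rateSP_mul ht).symm).le

lemma exists_achievable_of_mem_convexHull (N : ℕ) (hr : 1 ≤ r) (hC : 0 < C) :
    ∃ κ, ∀ F : ℕ, 0 < F →
      ∀ p ∈ convexHull ℝ (memoryRatePoint N C r F '' {t | t ≤ C ∧ C.choose t ∣ F}),
        Achievable N C r F κ p := by
  refine ⟨3 * ((Finset.range (C + 1)).lcm C.choose * (3 * 2 ^ C) + C.choose r * N),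
    fun F hF p hp => ?_⟩
  let T := (Finset.range (C + 1)).filter (C.choose · ∣ F)
  obtain ⟨Q, hQ⟩ : T.lcm C.choose ∣ F := Finset.lcm_dvd fun t ht => (Finset.mem_filter.1 ht).2
  have lcm_le : T.lcm C.choose ≤ (Finset.range (C + 1)).lcm C.choose :=
    Nat.le_of_dvd (Nat.pos_of_ne_zero (by simp [Finset.lcm_eq_zero_iff, Nat.choose_eq_zero_iff]))
      (Finset.lcm_mono (Finset.filter_subset _ _))
  have shared : Achievable N C r (T.lcm C.choose * Q)
      (3 * (T.lcm C.choose * (3 * 2 ^ C) + C.choose r * N)) p := by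
    refine Achievable.of_mem_convexHull (by positivity) ?_ ?_ ?_ hp Q
    · rintro _ ⟨t, -, rfl⟩
      exact rateSP_nonneg C r t
    · rintro _ ⟨t, ⟨ht, -⟩, rfl⟩
      exact rateSP_le ht
    · rintro _ ⟨t, ⟨ht, hd⟩, rfl⟩ k
      refine achievable_memoryRatePoint hr hC ht (Dvd.dvd.mul_right ?_ k) hF
      exact Finset.dvd_lcm (Finset.mem_filter.2 ⟨Finset.mem_range_succ_iff.2 ht, hd⟩)
  rw [hQ]
  refine shared.mono ?_
  gcongr

end Points

theorem theorem1_general (N C r : ℕ) (hr : 1 ≤ r) (hC : 0 < C) :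
    (∀ t ≤ C, ∀ F : ℕ, 0 < F → C.choose t ∣ F →
      ∃ m n : ℕ, (m : ℝ) = memorySP N C r F t * F ∧
        (n : ℝ) = rateSP C r t * F + (C.choose r : ℝ) * N ∧
        ∃ S : CachingScheme N C r F m n, S.IsSPLFR ∧ S.HasSubpacketization (C.choose t)) ∧
    (∀ F : ℕ, ∃ S : CachingScheme N C r F (N * F) 0, S.IsSPLFR) ∧
    (∃ κ : ℝ, ∀ F : ℕ, 0 < F →
      ∀ p ∈ convexHull ℝ (memoryRatePoint N C r F '' {t | t ≤ C ∧ C.choose t ∣ F}),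
        ∃ m n : ℕ, (m : ℝ) ≤ p.1 * F ∧ (n : ℝ) ≤ p.2 * F + κ ∧
          ∃ S : CachingScheme N C r F m n, S.IsSPLFR) := by
  obtain ⟨κ, hκ⟩ := exists_achievable_of_mem_convexHull N hr hC
  refine ⟨fun t ht F hF hd => ?_, fun F => ⟨_, (CachingScheme.isPerfect_uncoded hr).isSPLFR⟩,
    κ, fun F hF p hp => ?_⟩
  · obtain ⟨s, rfl⟩ := hd
    obtain ⟨S, hS, hsub⟩ := CachingScheme.exists_codedScheme (N := N) (C := C) hr t
      (le_ceil_div_mul (fieldDegree_pos r) s)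
    refine ⟨_, _, ?_, ?_, S, hS.isSPLFR, hsub⟩ <;> push_cast
    · exact (memorySP_mul hC ht (Nat.pos_of_mul_pos_left hF)).symm
    · rw [rateSP_mul ht]
  · obtain ⟨m, n, hm, hn, S, hS⟩ := hκ F hF p hp
    exact ⟨m, n, hm, hn, S, hS.isSPLFR⟩

theorem theorem1 (N C r : ℕ) (hr : 1 ≤ r) (hrC : r ≤ C) :
    (∀ t : ℕ, t ≤ C - r → ∀ F : ℕ, 0 < F → C.choose t ∣ F →
      ∃ m n : ℕ, (m : ℝ) = memorySP N C r F t * F ∧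
        (n : ℝ) = rateSP C r t * F + (C.choose r : ℝ) * N ∧
        ∃ S : CachingScheme N C r F m n, S.IsSPLFR ∧ S.HasSubpacketization (C.choose t)) ∧
    (∀ F : ℕ, 0 < F → ∃ S : CachingScheme N C r F (N * F) 0, S.IsSPLFR) ∧
    (∃ κ : ℝ, ∀ F : ℕ, 0 < F → (∀ t : ℕ, t ≤ C - r → C.choose t ∣ F) →
      ∀ M R : ℝ, (M, R) ∈ lowerConvexEnvelope (pointsSP N C r F) →
        ∃ m n : ℕ, (m : ℝ) ≤ M * F ∧ (n : ℝ) ≤ R * F + κ ∧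
          ∃ S : CachingScheme N C r F m n, S.IsSPLFR) := by
  have hC : 0 < C := by omega
  obtain ⟨coded, uncoded, κ, hull⟩ := theorem1_general N C r hr hC
  exact ⟨fun t ht => coded t (ht.trans (Nat.sub_le C r)), fun F _ => uncoded F, κ,
    fun F hF hd M R hMR => hull F hF (M, R)
      (convexHull_mono (pointsSP_subset_image hr hC F hd) hMR.1)⟩
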